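/- Let $d\ge 1$ and $N\ge 1$, and let $\Phi=\{\phi_k\}_{k=1}^N$ be maps of $\mathbb R^d$ (with the Euclidean metric) of the form $\phi_k(x)=T_kx+b_k$ with $T_k=\operatorname{diag}(T_{k,1},\dots,T_{k,d})$, $0<T_{k,i}<1$, and $b_k=(b_{k,1},\dots,b_{k,d})\in\mathbb R^d$. For $1\le\ell\le d$ let $\bar\pi_\ell(x_1,\dots,x_d)=(x_1,\dots,x_\ell)$, and let $\Phi_{\{1,\dots,\ell\}}$ be the set of maps $(x_1,\dots,x_\ell)\mapsto(T_{k,1}x_1+b_{k,1},\dots,T_{k,\ell}x_\ell+b_{k,\ell})$, $1\le k\le N$, in which coinciding maps are counted once. Let $K$ be the attractor of $\Phi$, i.e. the unique nonempty compact set with $K=\bigcup_{k}\phi_k(K)$, and suppose that $K$ is a self-affine sponge of Lalley–Gatzouras type, that is: $K\subset[0,1]^d$; $T_{k,1}>T_{k,2}>\dots>T_{k,d}$ for every $k$; and for each $1\le\ell\le d$ the sets $f((0,1)^\ell)$, $f\in\Phi_{\{1,\dots,\ell\}}$, are pairwise disjoint. The fiber IFSs of $K$ are: the set $G(\emptyset)=\Phi_{\{1\}}$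 (rank $0$), and, for $1\le\ell\le d-1$ and $u\in\Phi_{\{1,\dots,\ell\}}$, the set $G(u)=\{h:\mathbb R\to\mathbb R:\ (u,h)\in\Phi_{\{1,\dots,\ell+1\}}\}$ (rank $\ell$), where $(u,h)(x_1,\dots,x_{\ell+1})=(u(x_1,\dots,x_\ell),h(x_{\ell+1}))$. A metric space $(X,\rho)$ is uniformly disconnected if there is $\delta_0>0$ such that there are no $n\ge1$ and distinct points $x_0,\dots,x_n\in X$ with $\rho(x_i,x_{i+1})\le\delta_0\,\rho(x_0,x_n)$ for all $0\le i<n$. Then the following three statements are equivalent: (i) $K$ is uniformly disconnected; (ii) $\bar\pi_\ell(K)$ is totally disconnected for every $1\le\ell\le d$; (iii) no fiber IFS of $K$ (of any rank $0\le\ell\le d-1$) has attractor $[0,1]$. -/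

import Mathlib

open Set

noncomputable section

/-- A metric space is uniformly disconnected if for some `δ₀ > 0` it contains no `δ₀`-sequence,
that is, no finite sequence of `n + 1 ≥ 2` distinct points `x 0, …, x n` all of whose
consecutive distances are at most `δ₀ * dist (x 0) (x n)`. -/
def UniformlyDisconnected (X : Type*) [MetricSpace X] : Prop :=
  ∃ δ₀ : ℝ, 0 < δ₀ ∧ ¬ ∃ (n : ℕ) (x : Fin (n + 1) → X), 1 ≤ n ∧ Function.Injective x ∧
    ∀ i : Fin n, dist (x i.castSucc) (x i.succ) ≤ δ₀ * dist (x 0) (x (Fin.last n))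

/-- `A` is the attractor of the iterated function system `F` (in all uses a finite set of
contractions, so that such an `A` is unique): `A` is nonempty and compact,
and `A = ⋃ f ∈ F, f(A)`. -/
structure IsAttractor {X : Type*} [TopologicalSpace X] (F : Set (X → X)) (A : Set X) : Prop where
  nonempty : A.Nonempty
  isCompact : IsCompact A
  eq_biUnion : A = ⋃ f ∈ F, f '' A

/-- The diagonal affine map `x ↦ diag(a) x + b` of `ℝ^d`. -/
def diagMap {d : ℕ} (a b : Fin d → ℝ) (x : EuclideanSpace ℝ (Fin d)) : EuclideanSpace ℝ (Fin d) :=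
  WithLp.toLp 2 fun i => a i * x i + b i

/-- The major projection `(x₁, …, x_d) ↦ (x₁, …, x_ℓ)`, for `ℓ ≤ d`. -/
def majorProj {ℓ d : ℕ} (h : ℓ ≤ d) (x : EuclideanSpace ℝ (Fin d)) : EuclideanSpace ℝ (Fin ℓ) :=
  WithLp.toLp 2 fun i => x (Fin.castLE h i)

/-- The map `(u, h)` of `ℝ^(ℓ+1)`,
`(x₁, …, x_{ℓ+1}) ↦ (u(x₁, …, x_ℓ), h(x_{ℓ+1}))`. -/
def pairMap {ℓ : ℕ} (u : EuclideanSpace ℝ (Fin ℓ) → EuclideanSpace ℝ (Fin ℓ)) (h : ℝ → ℝ)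
    (x : EuclideanSpace ℝ (Fin (ℓ + 1))) : EuclideanSpace ℝ (Fin (ℓ + 1)) :=
  WithLp.toLp 2 (Fin.snoc (α := fun _ => ℝ) (fun i => u (majorProj (Nat.le_succ ℓ) x) i)
    (h (x (Fin.last ℓ))))

/-- A diagonal self-affine IFS on `ℝ^d`: maps `φ_k(x) = diag(ratio k) x + shift k`, `k < N`.
The diagonal entries are positive; that they are `< 1` says that the `φ_k` are contractions. -/
structure DiagonalIFS (d N : ℕ) where
  ratio : Fin N → Fin d → ℝ
  shift : Fin N → Fin d → ℝ
  ratio_pos : ∀ k i, 0 < ratio k i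
  ratio_lt_one : ∀ k i, ratio k i < 1

namespace DiagonalIFS

/-- The maps of the IFS. -/
def maps {d N : ℕ} (Φ : DiagonalIFS d N) :
    Set (EuclideanSpace ℝ (Fin d) → EuclideanSpace ℝ (Fin d)) :=
  Set.range fun k => diagMap (Φ.ratio k) (Φ.shift k)

/-- The `ℓ`-th major projection IFS on `ℝ^ℓ`, as a set of maps
(each map occurs at most once). -/
def projMaps {d N : ℕ} (Φ : DiagonalIFS d N) (ℓ : ℕ) (hℓ : ℓ ≤ d) :
    Set (EuclideanSpace ℝ (Fin ℓ) → EuclideanSpace ℝ (Fin ℓ)) :=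
  Set.range fun k =>
    diagMap (fun i => Φ.ratio k (Fin.castLE hℓ i)) (fun i => Φ.shift k (Fin.castLE hℓ i))

/-- The fiber IFS of a map `u` in the `ℓ`-th major projection IFS, `0 ≤ ℓ < d`: all `h : ℝ → ℝ`
such that `(u, h)` lies in the `(ℓ+1)`-th major projection IFS. For `ℓ = 0` the only `u` is the
identity of the one-point space `ℝ^0` (the root of the tree of maps), and its fiber IFS is the
first major projection IFS. -/
def fiberIFS {d N : ℕ} (Φ : DiagonalIFS d N) (ℓ : ℕ) (hℓ : ℓ < d)
    (u : EuclideanSpace ℝ (Fin ℓ) → EuclideanSpace ℝ (Fin ℓ)) : Set (ℝ → ℝ) :=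
  {h | pairMap u h ∈ Φ.projMaps (ℓ + 1) hℓ}

/-- `ratio k 1 > ratio k 2 > ⋯ > ratio k d` for all `k`. -/
def CoordinateOrdering {d N : ℕ} (Φ : DiagonalIFS d N) : Prop :=
  ∀ k, StrictAnti (Φ.ratio k)

/-- For each `1 ≤ ℓ ≤ d`, the images of the open unit cube of `ℝ^ℓ` under the different maps of
the `ℓ`-th major projection IFS are pairwise disjoint. -/
def NeatProjection {d N : ℕ} (Φ : DiagonalIFS d N) : Prop :=
  ∀ (ℓ : ℕ) (hℓ : ℓ ≤ d), 1 ≤ ℓ →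
    (Φ.projMaps ℓ hℓ).PairwiseDisjoint
      fun f => f '' {x : EuclideanSpace ℝ (Fin ℓ) | ∀ i, x i ∈ Ioo (0 : ℝ) 1}

/-- `K` is the self-affine sponge of Lalley–Gatzouras type generated by `Φ`: it is the attractor
of `Φ`, it lies in the unit cube, and `Φ` satisfies the coordinate ordering condition and the
neat projection condition. -/
structure IsLalleyGatzourasSponge {d N : ℕ} (Φ : DiagonalIFS d N)
    (K : Set (EuclideanSpace ℝ (Fin d))) : Prop where
  isAttractor : IsAttractor Φ.maps K
  subset_cube : ∀ x ∈ K, ∀ i, x i ∈ Icc (0 : ℝ) 1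
  coordinateOrdering : Φ.CoordinateOrdering
  neatProjection : Φ.NeatProjection

end DiagonalIFS

end

open Set

/-! If some fiber IFS of rank ℓ is full, every map in it lies over the same `u`, so the fiber of `K`
over the fixed point of `u` projects onto [0,1] in the next coordinate (`exists_mem_fiber`). This
gives a segment in a projection of `K`. Evenly spaced points of the fiber, pushed by a high iterate
of `φ_k`, also give a δ-sequence in `K`: their first ℓ coordinates coincide, and the later
coordinates contract faster than coordinate ℓ.

Conversely, suppose that no fiber IFS is full. By finiteness all fiber IFSs leave gaps of a common
size. Cut `K` into boxes by words stopped according to a weight `q` that dominates the ratios in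
direction ℓ and is dominated by those in directions below ℓ; the coordinate ordering allows this
(`exists_weight`). At scale r the boxes are then wide in the base and thin in direction ℓ. Boundedly
many base boxes come near a given point, and self-similarity produces a hole proportional to r
missed by all the fibers over them (`exists_fiber_hole`). Chains with small steps cannot jump these
holes, so induction on ℓ confines them (`ChainBound.succ`). The resulting `ChainBound` gives uniform
disconnectedness of `K` and total disconnectedness of every projection. -/

theorem exists_pos_le_of_finite {ι : Type*} [Finite ι] (f : ι → ℝ) (hf : ∀ i, 0 < f i) :
    ∃ c > 0, ∀ i, c ≤ f i := by
  rcases isEmpty_or_nonempty ι with h | h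
  · exact ⟨1, one_pos, fun i => h.elim i⟩
  · obtain ⟨i, hi⟩ := Finite.exists_min f
    exact ⟨f i, hf i, hi⟩

namespace DiagonalIFS

variable {d N : ℕ}

/-! ### Words, their boxes, and separation -/

/-- Two indices give the same map of the `ℓ`-th major projection IFS. -/
def Agree (Φ : DiagonalIFS d N) (ℓ : ℕ) (k k' : Fin N) : Prop :=
  ∀ j : Fin d, j.val < ℓ → Φ.ratio k j = Φ.ratio k' j ∧ Φ.shift k j = Φ.shift k' j

theorem Agree.refl (Φ : DiagonalIFS d N) (ℓ : ℕ) (k : Fin N) : Φ.Agree ℓ k k :=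
  fun _ _ => ⟨rfl, rfl⟩

theorem Agree.symm {Φ : DiagonalIFS d N} {ℓ : ℕ} {k k' : Fin N} (h : Φ.Agree ℓ k k') :
    Φ.Agree ℓ k' k := fun j hj => ⟨(h j hj).1.symm, (h j hj).2.symm⟩

theorem Agree.trans {Φ : DiagonalIFS d N} {ℓ : ℕ} {k k' k'' : Fin N} (h : Φ.Agree ℓ k k')
    (h' : Φ.Agree ℓ k' k'') : Φ.Agree ℓ k k'' :=
  fun j hj => ⟨(h j hj).1.trans (h' j hj).1, (h j hj).2.trans (h' j hj).2⟩

/-- The contraction ratios of the composition along a word. -/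
def wordRatio (Φ : DiagonalIFS d N) (w : List (Fin N)) (j : Fin d) : ℝ :=
  (w.map fun k => Φ.ratio k j).prod

/-- The translation part of the composition along a word. -/
def wordShift (Φ : DiagonalIFS d N) : List (Fin N) → Fin d → ℝ
  | [], _ => 0
  | k :: w, j => Φ.ratio k j * Φ.wordShift w j + Φ.shift k j

/-- The side in direction `j` of the image of the unit cube under the composition along a word. -/
def wordIcc (Φ : DiagonalIFS d N) (w : List (Fin N)) (j : Fin d) : Set ℝ :=
  Icc (Φ.wordShift w j) (Φ.wordShift w j + Φ.wordRatio w j)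

@[simp] theorem wordRatio_nil (Φ : DiagonalIFS d N) (j : Fin d) : Φ.wordRatio [] j = 1 := rfl

@[simp] theorem wordRatio_cons (Φ : DiagonalIFS d N) (k : Fin N) (w : List (Fin N)) (j : Fin d) :
    Φ.wordRatio (k :: w) j = Φ.ratio k j * Φ.wordRatio w j := by simp [wordRatio]

@[simp] theorem wordShift_nil (Φ : DiagonalIFS d N) (j : Fin d) : Φ.wordShift [] j = 0 := rfl

@[simp] theorem wordShift_cons (Φ : DiagonalIFS d N) (k : Fin N) (w : List (Fin N)) (j : Fin d) :
    Φ.wordShift (k :: w) j = Φ.ratio k j * Φ.wordShift w j + Φ.shift k j := rfl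

theorem wordIcc_nil (Φ : DiagonalIFS d N) (j : Fin d) : Φ.wordIcc [] j = Icc 0 1 := by
  simp [wordIcc]

theorem mem_wordIcc_cons (Φ : DiagonalIFS d N) (k : Fin N) (w : List (Fin N)) (j : Fin d) (z : ℝ) :
    z ∈ Φ.wordIcc (k :: w) j ↔ (z - Φ.shift k j) / Φ.ratio k j ∈ Φ.wordIcc w j := by
  have := Φ.ratio_pos k j
  simp only [wordIcc, wordShift_cons, wordRatio_cons, mem_Icc, le_div_iff₀ this,
    div_le_iff₀ this]
  constructor <;> rintro ⟨h1, h2⟩ <;> constructor <;> linarith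

/-- The maps of the IFS send the unit cube into itself. -/
def PreservesCube (Φ : DiagonalIFS d N) : Prop :=
  ∀ k j, 0 ≤ Φ.shift k j ∧ Φ.shift k j + Φ.ratio k j ≤ 1

theorem PreservesCube.wordShift_bounds {Φ : DiagonalIFS d N} (h : Φ.PreservesCube)
    (w : List (Fin N)) (j : Fin d) :
    0 ≤ Φ.wordShift w j ∧ Φ.wordShift w j + Φ.wordRatio w j ≤ 1 := by
  induction w with
  | nil => simp
  | cons k w ih =>
    have := Φ.ratio_pos k j
    obtain ⟨h1, h2⟩ := h k j
    simp only [wordShift_cons, wordRatio_cons]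
    constructor
    · have := mul_nonneg this.le ih.1
      linarith
    · have := mul_le_mul_of_nonneg_left ih.2 this.le
      linarith

theorem PreservesCube.wordShift_cons_bounds {Φ : DiagonalIFS d N} (h : Φ.PreservesCube)
    (k : Fin N) (w : List (Fin N)) (j : Fin d) :
    Φ.shift k j ≤ Φ.wordShift (k :: w) j ∧
      Φ.wordShift (k :: w) j + Φ.wordRatio (k :: w) j ≤ Φ.shift k j + Φ.ratio k j := by
  have := Φ.ratio_pos k j
  obtain ⟨h1, h2⟩ := h.wordShift_bounds w j
  simp only [wordShift_cons, wordRatio_cons]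
  constructor
  · have := mul_nonneg this.le h1
    linarith
  · have := mul_le_mul_of_nonneg_left h2 this.le
    linarith

/-- Coordinatewise form of the neat projection condition. -/
def Separated (Φ : DiagonalIFS d N) : Prop :=
  ∀ ℓ ≤ d, ∀ k k', Φ.Agree ℓ k k' ∨ ∃ j : Fin d, j.val < ℓ ∧
    (Φ.shift k j + Φ.ratio k j ≤ Φ.shift k' j ∨ Φ.shift k' j + Φ.ratio k' j ≤ Φ.shift k j)

theorem diagMap_image_cube {ℓ : ℕ} {a b : Fin ℓ → ℝ} (ha : ∀ i, 0 < a i)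
    {y : EuclideanSpace ℝ (Fin ℓ)} (hy : ∀ i, b i < y i ∧ y i < b i + a i) :
    y ∈ diagMap a b '' {x : EuclideanSpace ℝ (Fin ℓ) | ∀ i, x i ∈ Ioo (0 : ℝ) 1} := by
  refine ⟨WithLp.toLp 2 fun i => (y i - b i) / a i, fun i => ?_, ?_⟩
  · have := hy i
    constructor
    · exact div_pos (by linarith) (ha i)
    · show (y i - b i) / a i < 1
      rw [div_lt_one (ha i)]; linarith
  · ext i
    have := (ha i).ne'
    simp only [diagMap]
    field_simp
    ring

theorem diagMap_injective {ℓ : ℕ} {a b a' b' : Fin ℓ → ℝ} (h : diagMap a b = diagMap a' b') :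
    a = a' ∧ b = b' := by
  have h0 : b = b' := by
    funext i
    have := congrArg (fun y : EuclideanSpace ℝ (Fin ℓ) => y i) (congrFun h 0)
    simpa [diagMap] using this
  refine ⟨?_, h0⟩
  funext i
  have := congrArg (fun y : EuclideanSpace ℝ (Fin ℓ) => y i) (congrFun h (WithLp.toLp 2 fun _ => 1))
  simpa [diagMap, h0] using this

/-- If the sides overlap in every direction below ℓ, the midpoints of the overlaps form a point
common to both open boxes. -/
theorem NeatProjection.separated {Φ : DiagonalIFS d N} (h : Φ.NeatProjection) : Φ.Separated := by
  intro ℓ hℓ k k'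
  rcases Nat.eq_zero_or_pos ℓ with rfl | hpos
  · exact Or.inl fun j hj => absurd hj (Nat.not_lt_zero _)
  by_contra! hcon
  obtain ⟨hne, hov⟩ := hcon
  have key := h ℓ hℓ hpos (x := _) ⟨k, rfl⟩ (y := _) ⟨k', rfl⟩ ?_
  · let y : EuclideanSpace ℝ (Fin ℓ) := WithLp.toLp 2 fun i =>
      (max (Φ.shift k (i.castLE hℓ)) (Φ.shift k' (i.castLE hℓ)) +
        min (Φ.shift k (i.castLE hℓ) + Φ.ratio k (i.castLE hℓ))
          (Φ.shift k' (i.castLE hℓ) + Φ.ratio k' (i.castLE hℓ))) / 2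
    have hlt : ∀ i : Fin ℓ, max (Φ.shift k (i.castLE hℓ)) (Φ.shift k' (i.castLE hℓ)) <
        min (Φ.shift k (i.castLE hℓ) + Φ.ratio k (i.castLE hℓ))
          (Φ.shift k' (i.castLE hℓ) + Φ.ratio k' (i.castLE hℓ)) := by
      intro i
      obtain ⟨h1, h2⟩ := hov (i.castLE hℓ) i.isLt
      have p1 := Φ.ratio_pos k (i.castLE hℓ)
      have p2 := Φ.ratio_pos k' (i.castLE hℓ)
      rw [max_lt_iff, lt_min_iff, lt_min_iff]
      refine ⟨⟨?_, ?_⟩, ?_, ?_⟩ <;> linarith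
    have hy : ∀ i, max (Φ.shift k (i.castLE hℓ)) (Φ.shift k' (i.castLE hℓ)) < y i ∧ y i <
        min (Φ.shift k (i.castLE hℓ) + Φ.ratio k (i.castLE hℓ))
          (Φ.shift k' (i.castLE hℓ) + Φ.ratio k' (i.castLE hℓ)) := by
      intro i
      have := hlt i
      constructor
      · show _ < (_ + _) / 2
        linarith
      · show (_ + _) / 2 < _
        linarith
    exact Set.disjoint_left.1 key
      (diagMap_image_cube (fun i => Φ.ratio_pos _ _) fun i =>
        ⟨(le_max_left _ _).trans_lt (hy i).1, (hy i).2.trans_le (min_le_left _ _)⟩)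
      (diagMap_image_cube (fun i => Φ.ratio_pos _ _) fun i =>
        ⟨(le_max_right _ _).trans_lt (hy i).1, (hy i).2.trans_le (min_le_right _ _)⟩)
  · intro heq
    obtain ⟨h1, h2⟩ := diagMap_injective heq
    exact hne fun j hj => ⟨congrFun h1 ⟨j, hj⟩, congrFun h2 ⟨j, hj⟩⟩

/-! ### Words stopped at a given scale -/

/-- A word whose product of the weights `q` has just dropped to at most `s`. -/
def IsStopped (q : Fin N → ℝ) : ℝ → List (Fin N) → Prop
  | s, [] => 1 ≤ s
  | s, k :: w => s < 1 ∧ IsStopped q (s / q k) w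

theorem IsStopped.prod_le {q : Fin N → ℝ} (hq : ∀ k, 0 < q k) {s : ℝ} {w : List (Fin N)}
    (h : IsStopped q s w) : (w.map q).prod ≤ s := by
  induction w generalizing s with
  | nil => simpa [IsStopped] using h
  | cons k w ih =>
    have := ih h.2
    rw [le_div_iff₀ (hq k)] at this
    simp only [List.map_cons, List.prod_cons]
    linarith

/-- Before its last letter the product still exceeds s, and one letter costs a factor of at least ρ.
-/
theorem IsStopped.le_prod {q : Fin N → ℝ} {ρ : ℝ} (hρ : 0 < ρ) (hq : ∀ k, ρ ≤ q k) {s : ℝ}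
    {w : List (Fin N)} (hs : ρ * s ≤ 1) (h : IsStopped q s w) : ρ * s ≤ (w.map q).prod := by
  induction w generalizing s with
  | nil => simpa using hs
  | cons k w ih =>
    have hk := hρ.trans_le (hq k)
    have h1 : ρ * (s / q k) ≤ 1 := by
      rw [← mul_div_assoc, div_le_one hk]
      nlinarith [h.1, hq k]
    have := ih h1 h.2
    rw [← mul_div_assoc, div_le_iff₀ hk] at this
    simp only [List.map_cons, List.prod_cons]
    linarith

/-- As long as letters agree, the thresholds stay equal, so neither word can stop before the other.
The first disagreement separates the boxes, and the common affine prefix preserves this. -/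
theorem IsStopped.forall₂_or_separated {Φ : DiagonalIFS d N} (hsep : Φ.Separated)
    (hc : Φ.PreservesCube) {ℓ : ℕ} (hℓ : ℓ ≤ d) {q : Fin N → ℝ}
    (hq : ∀ k k', Φ.Agree ℓ k k' → q k = q k') {s : ℝ} {w w' : List (Fin N)}
    (h : IsStopped q s w) (h' : IsStopped q s w') :
    List.Forall₂ (Φ.Agree ℓ) w w' ∨ ∃ j : Fin d, j.val < ℓ ∧
      (Φ.wordShift w j + Φ.wordRatio w j ≤ Φ.wordShift w' j ∨
        Φ.wordShift w' j + Φ.wordRatio w' j ≤ Φ.wordShift w j) := by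
  induction w generalizing s w' with
  | nil =>
    cases w' with
    | nil => exact Or.inl .nil
    | cons k' w' => exact absurd h'.1 (not_lt.2 h)
  | cons k w ih =>
    cases w' with
    | nil => exact absurd h.1 (not_lt.2 h')
    | cons k' w' =>
      rcases hsep ℓ hℓ k k' with hk | ⟨j, hj, hk⟩
      · have h2 := h'.2
        rw [← hq k k' hk] at h2
        rcases ih h.2 h2 with hw | ⟨j, hj, hw⟩
        · exact Or.inl (.cons hk hw)
        · refine Or.inr ⟨j, hj, ?_⟩
          have hp := (Φ.ratio_pos k j).le
          simp only [wordShift_cons, wordRatio_cons, ← (hk j hj).1, ← (hk j hj).2]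
          rcases hw with hw | hw
          · left
            have := mul_le_mul_of_nonneg_left hw hp
            linarith
          · right
            have := mul_le_mul_of_nonneg_left hw hp
            linarith
      · refine Or.inr ⟨j, hj, ?_⟩
        have h1 := hc.wordShift_cons_bounds k w j
        have h2 := hc.wordShift_cons_bounds k' w' j
        rcases hk with hk | hk
        · left; linarith
        · right; linarith

theorem exists_isStopped {Φ : DiagonalIFS d N} {K : Set (EuclideanSpace ℝ (Fin d))}
    (hcube : ∀ x ∈ K, ∀ i, x i ∈ Icc (0 : ℝ) 1)
    (hpre : ∀ z ∈ K, ∃ k, ∃ z' ∈ K, ∀ j, z j = Φ.ratio k j * z' j + Φ.shift k j)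
    {q : Fin N → ℝ} (hq0 : ∀ k, 0 < q k) (hq1 : ∀ k, q k < 1) {s : ℝ} (hs : 0 < s)
    {z : EuclideanSpace ℝ (Fin d)} (hz : z ∈ K) :
    ∃ w, IsStopped q s w ∧ ∀ j, z j ∈ Φ.wordIcc w j := by
  obtain ⟨c, hc0, hc⟩ := exists_pos_le_of_finite (fun k => 1 - q k) fun k => by
    linarith [hq1 k]
  obtain ⟨k₀, -⟩ := hpre z hz
  have hc1 : 1 - c < 1 := by linarith
  have hc2 : 0 ≤ 1 - c := by linarith [hc k₀, hq0 k₀]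
  -- All weights are at most 1 - c, so n bounds the length of the word and serves for the induction.
  obtain ⟨n, hn⟩ := exists_pow_lt_of_lt_one hs hc1
  induction n generalizing s z with
  | zero =>
    refine ⟨[], ?_, fun j => ?_⟩
    · simpa [IsStopped] using hn.le
    · simpa [wordIcc_nil] using hcube z hz j
  | succ n ih =>
    by_cases h1 : 1 ≤ s
    · exact ⟨[], h1, fun j => by simpa [wordIcc_nil] using hcube z hz j⟩
    · obtain ⟨k, z', hz', hk⟩ := hpre z hz
      obtain ⟨w, hw, hw'⟩ := ih (s := s / q k) (div_pos hs (hq0 k)) hz' (by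
        rw [lt_div_iff₀ (hq0 k)]
        refine lt_of_le_of_lt ?_ hn
        rw [pow_succ]
        exact mul_le_mul_of_nonneg_left (by linarith [hc k]) (pow_nonneg hc2 n))
      refine ⟨k :: w, ⟨not_le.1 h1, hw⟩, fun j => ?_⟩
      rw [mem_wordIcc_cons, hk j]
      have := (Φ.ratio_pos k j).ne'
      have e : (Φ.ratio k j * z' j + Φ.shift k j - Φ.shift k j) / Φ.ratio k j = z' j := by
        field_simp
        ring
      rw [e]
      exact hw' j

/-! ### Holes in the fibers -/

/-- Zoom in along the word until the rescaled radius reaches 1; the gap of the current fiber IFS is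
then a hole within reach of z. The bound `r * ρ ≤ 1` survives each zoom and keeps the hole shorter
than g; the small weight ensures that the word does not run out first. -/
theorem exists_hole_of_mem_wordIcc {Φ : DiagonalIFS d N} (hsep : Φ.Separated)
    (hcube : Φ.PreservesCube) {ℓ : ℕ} (hℓ : ℓ < d) {q : Fin N → ℝ}
    (hq : ∀ k, Φ.ratio k ⟨ℓ, hℓ⟩ ≤ q k) {ρ g c : ℝ} (hρ : 0 < ρ)
    (hρr : ∀ k, ρ ≤ Φ.ratio k ⟨ℓ, hℓ⟩)
    (hgap : ∀ k, ∃ a, 0 ≤ a ∧ a + g ≤ 1 ∧ ∀ k', Φ.Agree ℓ k k' → ∀ y ∈ Ioo a (a + g),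
      y ∉ Icc (Φ.shift k' ⟨ℓ, hℓ⟩) (Φ.shift k' ⟨ℓ, hℓ⟩ + Φ.ratio k' ⟨ℓ, hℓ⟩))
    (hc : 0 < c) (hcg : c ≤ g * ρ) (hcρ : c < ρ) (w : List (Fin N)) {z r : ℝ} (hr : 0 < r)
    (hr1 : r * ρ ≤ 1) (hz : z ∈ Φ.wordIcc w ⟨ℓ, hℓ⟩) (hw : (w.map q).prod ≤ c * r) :
    ∃ a, 0 ≤ a ∧ a + c * r ≤ 1 ∧ z - r ≤ a ∧ a + c * r ≤ z + r ∧
      ∀ v, List.Forall₂ (Φ.Agree ℓ) w v → ∀ y ∈ Ioo a (a + c * r), y ∉ Φ.wordIcc v ⟨ℓ, hℓ⟩ := by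
  have hb := fun w => hcube.wordShift_bounds w ⟨ℓ, hℓ⟩
  have hbc := fun k w => hcube.wordShift_cons_bounds k w ⟨ℓ, hℓ⟩
  induction w generalizing z r with
  | nil =>
    simp only [List.map_nil, List.prod_nil] at hw
    nlinarith
  | cons k w ih =>
    have hz0 := (hb (k :: w)).1.trans hz.1
    have hz1 := hz.2.trans (hb (k :: w)).2
    rcases le_total 1 r with h1 | h1
    · obtain ⟨a, ha0, ha1, ha⟩ := hgap k
      have hcr : c * r ≤ g := by
        have : c * r ≤ g * ρ * r := mul_le_mul_of_nonneg_right hcg hr.le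
        have hg : 0 ≤ g := by
          by_contra hg
          have := mul_pos_of_neg_of_neg (not_le.1 hg) (neg_lt_zero.2 hρ)
          linarith
        nlinarith [mul_le_mul_of_nonneg_left hr1 hg]
      refine ⟨a, ha0, by linarith, by linarith, by linarith, ?_⟩
      intro v hv y hy hyv
      cases hv with
      | @cons _ k' _ v' hk hv =>
        have := hbc k' v'
        exact ha k' hk y ⟨hy.1, by linarith [hy.2]⟩
          ⟨this.1.trans hyv.1, hyv.2.trans this.2⟩
    · set t := Φ.ratio k ⟨ℓ, hℓ⟩ with ht
      set b := Φ.shift k ⟨ℓ, hℓ⟩ with hb'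
      have htp : 0 < t := Φ.ratio_pos _ _
      have hqp : 0 < q k := htp.trans_le (hq k)
      rw [mem_wordIcc_cons] at hz
      obtain ⟨a, ha0, ha1, haz, haz', ha⟩ := ih (z := (z - b) / t) (r := r / t) (div_pos hr htp)
        (by
          rw [div_mul_eq_mul_div, div_le_one htp]
          exact (mul_le_of_le_one_left hρ.le h1).trans (hρr k)) hz (by
          simp only [List.map_cons, List.prod_cons] at hw
          have h2 : (w.map q).prod ≤ c * r / q k := by
            rw [le_div_iff₀ hqp]; linarith
          refine h2.trans ?_
          rw [← mul_div_assoc]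
          exact div_le_div_of_nonneg_left (mul_pos hc hr).le htp (hq k))
      have e1 : t * (c * (r / t)) = c * r := by field_simp
      have e2 : t * (r / t) = r := by field_simp
      have e3 : t * ((z - b) / t) = z - b := by field_simp
      have f0 := mul_nonneg htp.le ha0
      have f1 := mul_le_mul_of_nonneg_left ha1 htp.le
      have f2 := mul_le_mul_of_nonneg_left haz htp.le
      have f3 := mul_le_mul_of_nonneg_left haz' htp.le
      obtain ⟨g0, g1⟩ := hcube k ⟨ℓ, hℓ⟩
      rw [mul_add, e1] at f1 f3
      rw [mul_sub, e2, e3] at f2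
      rw [mul_add, e2, e3] at f3
      refine ⟨t * a + b, by linarith, by linarith, by linarith, by linarith, ?_⟩
      intro v hv y hy hyv
      cases hv with
      | @cons _ k' _ v' hk hv =>
        -- Either k' acts like k in direction ℓ too, and the inductive hole applies, or its interval
        -- lies beside that of k, which contains the hole.
        rcases hsep (ℓ + 1) hℓ k k' with hkk | ⟨j, hj, hs⟩
        · rw [mem_wordIcc_cons, ← (hkk ⟨ℓ, hℓ⟩ (Nat.lt_succ_self ℓ)).1,
            ← (hkk ⟨ℓ, hℓ⟩ (Nat.lt_succ_self ℓ)).2] at hyv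
          refine ha v' hv _ ⟨?_, ?_⟩ hyv
          · rw [lt_div_iff₀ htp]; linarith [hy.1]
          · rw [div_lt_iff₀ htp, add_mul, mul_comm _ t, mul_comm (c * (r / t)), e1]
            linarith [hy.2]
        · have p1 := Φ.ratio_pos k j
          have p2 := Φ.ratio_pos k' j
          rcases Nat.lt_succ_iff_lt_or_eq.1 hj with hj | hj
          · rw [← (hk j hj).1, ← (hk j hj).2] at hs
            rcases hs with hs | hs <;> linarith
          · obtain rfl : j = ⟨ℓ, hℓ⟩ := Fin.ext hj
            have := hbc k' v'
            have h3 := hyv.1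
            have h4 := hyv.2
            have h5 := hy.1
            have h6 := hy.2
            rcases hs with hs | hs <;> linarith

/-- Every interval contains, in proportion `c`, an interval missed by the fiber in direction `ℓ`
of any given word of small weight. -/
def HasHoles (Φ : DiagonalIFS d N) {ℓ : ℕ} (hℓ : ℓ < d) (q : Fin N → ℝ) (c : ℝ) : Prop :=
  ∀ (w : List (Fin N)) (a r : ℝ), 0 < r → r ≤ 1 → (w.map q).prod ≤ c * r →
    ∃ a', a ≤ a' ∧ a' + c * r ≤ a + r ∧ ∀ v, List.Forall₂ (Φ.Agree ℓ) w v →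
      ∀ y ∈ Ioo a' (a' + c * r), y ∉ Φ.wordIcc v ⟨ℓ, hℓ⟩

theorem forall₂_agree_trans {Φ : DiagonalIFS d N} {ℓ : ℕ} {u v w : List (Fin N)}
    (h : List.Forall₂ (Φ.Agree ℓ) u v) (h' : List.Forall₂ (Φ.Agree ℓ) v w) :
    List.Forall₂ (Φ.Agree ℓ) u w := by
  induction h generalizing w with
  | nil => exact h'
  | cons h _ ih =>
    cases h' with
    | cons h1 h2 => exact .cons (h.trans h1) (ih h2)

theorem forall₂_agree_symm {Φ : DiagonalIFS d N} {ℓ : ℕ} {u v : List (Fin N)}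
    (h : List.Forall₂ (Φ.Agree ℓ) u v) : List.Forall₂ (Φ.Agree ℓ) v u := by
  induction h with
  | nil => exact .nil
  | cons h _ ih => exact .cons h.symm ih

theorem prod_map_eq_of_forall₂ {Φ : DiagonalIFS d N} {ℓ : ℕ} {q : Fin N → ℝ}
    (hq : ∀ k k', Φ.Agree ℓ k k' → q k = q k') {u v : List (Fin N)}
    (h : List.Forall₂ (Φ.Agree ℓ) u v) : (u.map q).prod = (v.map q).prod := by
  induction h with
  | nil => rfl
  | cons h _ ih => simp [ih, hq _ _ h]

/-- Either the middle half of the interval is free, or it contains a fiber point and there is a hole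
within r/4 of it. -/
theorem exists_hasHoles {Φ : DiagonalIFS d N} (hsep : Φ.Separated)
    (hcube : Φ.PreservesCube) {ℓ : ℕ} (hℓ : ℓ < d) {q : Fin N → ℝ}
    (hq : ∀ k, Φ.ratio k ⟨ℓ, hℓ⟩ ≤ q k) (hqa : ∀ k k', Φ.Agree ℓ k k' → q k = q k')
    {ρ g : ℝ} (hρ : 0 < ρ) (hρ1 : ρ ≤ 1) (hρr : ∀ k, ρ ≤ Φ.ratio k ⟨ℓ, hℓ⟩) (hg : 0 < g)
    (hgap : ∀ k, ∃ a, 0 ≤ a ∧ a + g ≤ 1 ∧ ∀ k', Φ.Agree ℓ k k' → ∀ y ∈ Ioo a (a + g),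
      y ∉ Icc (Φ.shift k' ⟨ℓ, hℓ⟩) (Φ.shift k' ⟨ℓ, hℓ⟩ + Φ.ratio k' ⟨ℓ, hℓ⟩)) :
    ∃ c, 0 < c ∧ c ≤ 1 ∧ Φ.HasHoles hℓ q c := by
  obtain ⟨c, hc0, hcg, hcρ⟩ : ∃ c, 0 < c ∧ c ≤ g * ρ ∧ c < ρ :=
    ⟨min (g * ρ) (ρ / 2), by positivity, min_le_left _ _, (min_le_right _ _).trans_lt (by linarith)⟩
  refine ⟨c / 4, by positivity, by linarith, fun w a r hr hr1 hw => ?_⟩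
  have hcr : c * r ≤ r := mul_le_of_le_one_left hr.le (hcρ.le.trans hρ1)
  by_cases h : ∃ v, List.Forall₂ (Φ.Agree ℓ) w v ∧ ∃ z ∈ Ioo (a + r / 4) (a + 3 * r / 4),
      z ∈ Φ.wordIcc v ⟨ℓ, hℓ⟩
  · obtain ⟨v, hv, z, hz, hzv⟩ := h
    obtain ⟨a', -, -, h1, h2, h3⟩ := exists_hole_of_mem_wordIcc hsep hcube hℓ hq hρ hρr hgap hc0
      hcg hcρ v (r := r / 4) (by positivity) (by nlinarith) hzv (by
        rw [← prod_map_eq_of_forall₂ hqa hv]; linarith)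
    rw [← mul_div_right_comm, ← mul_div_assoc] at *
    refine ⟨a', by linarith [hz.1], by linarith [hz.2], fun v' hv' => ?_⟩
    exact h3 v' (forall₂_agree_trans (forall₂_agree_symm hv) hv')
  · push Not at h
    refine ⟨a + r / 4, by linarith, by linarith, fun v hv y hy => h v hv y ⟨hy.1, ?_⟩⟩
    linarith [hy.2]

/-- Nest the holes: each class of words costs one factor c. -/
theorem HasHoles.exists_common {Φ : DiagonalIFS d N} {ℓ : ℕ} {hℓ : ℓ < d} {q : Fin N → ℝ} {c : ℝ}
    (h : Φ.HasHoles hℓ q c) (hc0 : 0 < c) (hc1 : c ≤ 1) {ι : Type*} (S : ι → Set (List (Fin N)))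
    (hS : ∀ i, ∀ w ∈ S i, ∀ w' ∈ S i, List.Forall₂ (Φ.Agree ℓ) w w') (T : Finset ι)
    {r : ℝ} (hr0 : 0 < r) (hr1 : r ≤ 1) (a : ℝ)
    (hT : ∀ i, ∀ w ∈ S i, (w.map q).prod ≤ c ^ T.card * r) :
    ∃ a', a ≤ a' ∧ a' + c ^ T.card * r ≤ a + r ∧ ∀ i ∈ T, ∀ w ∈ S i,
      ∀ y ∈ Ioo a' (a' + c ^ T.card * r), y ∉ Φ.wordIcc w ⟨ℓ, hℓ⟩ := by
  classical
  induction T using Finset.induction_on generalizing r a with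
  | empty => exact ⟨a, le_rfl, by simp, by simp⟩
  | insert i T hi ih =>
    rw [Finset.card_insert_of_notMem hi] at *
    have hcc : c ^ (T.card + 1) * r = c ^ T.card * (c * r) := by ring
    have hcr : c * r ≤ r := mul_le_of_le_one_left hr0.le hc1
    simp only [hcc] at hT ⊢
    have hle : c ^ T.card * (c * r) ≤ c * r :=
      mul_le_of_le_one_left (by positivity) (pow_le_one₀ hc0.le hc1)
    obtain ⟨a₁, h1, h2, h3⟩ : ∃ a₁, a ≤ a₁ ∧ a₁ + c * r ≤ a + r ∧ ∀ w ∈ S i,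
        ∀ y ∈ Ioo a₁ (a₁ + c * r), y ∉ Φ.wordIcc w ⟨ℓ, hℓ⟩ := by
      rcases (S i).eq_empty_or_nonempty with he | ⟨w, hw⟩
      · exact ⟨a, le_rfl, by linarith, by simp [he]⟩
      · obtain ⟨a₁, h1, h2, h3⟩ := h w a r hr0 hr1 ((hT i w hw).trans hle)
        exact ⟨a₁, h1, h2, fun v hv => h3 v (hS i w hw v hv)⟩
    obtain ⟨a₂, h4, h5, h6⟩ := ih (r := c * r) (by positivity) (hcr.trans hr1) a₁ hT
    refine ⟨a₂, h1.trans h4, h5.trans h2, fun i' hi' w hw y hy => ?_⟩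
    rcases Finset.mem_insert.1 hi' with rfl | hi'
    · exact h3 w hw y ⟨h4.trans_lt hy.1, hy.2.trans_le h5⟩
    · exact h6 i' hi' w hw y hy

theorem le_wordRatio {Φ : DiagonalIFS d N} {q : Fin N → ℝ} (hq0 : ∀ k, 0 ≤ q k) {j : Fin d}
    (hq : ∀ k, q k ≤ Φ.ratio k j) (w : List (Fin N)) : (w.map q).prod ≤ Φ.wordRatio w j := by
  induction w with
  | nil => simp
  | cons k w ih =>
    simp only [List.map_cons, List.prod_cons, wordRatio_cons]
    exact mul_le_mul (hq k) ih (List.prod_nonneg (by simpa using fun k _ => hq0 k))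
      (Φ.ratio_pos k j).le

/-- Near each point and at each scale there is an interval in direction `ℓ` missed by `K`. -/
theorem exists_fiber_hole {Φ : DiagonalIFS d N} (hsep : Φ.Separated)
    (hcube : Φ.PreservesCube) {K : Set (EuclideanSpace ℝ (Fin d))}
    (hK : ∀ x ∈ K, ∀ i, x i ∈ Icc (0 : ℝ) 1)
    (hpre : ∀ z ∈ K, ∃ k, ∃ z' ∈ K, ∀ j, z j = Φ.ratio k j * z' j + Φ.shift k j)
    {ℓ : ℕ} (hℓ : ℓ < d) {q : Fin N → ℝ} (hqa : ∀ k k', Φ.Agree ℓ k k' → q k = q k')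
    (hqr : ∀ k, ∀ j : Fin d, j.val < ℓ → q k ≤ Φ.ratio k j) {ρ : ℝ} (hρ : 0 < ρ) (hρ1 : ρ ≤ 1)
    (hρq : ∀ k, ρ ≤ q k) (hq1 : ∀ k, q k < 1)
    {c₀ : ℝ} (hc0 : 0 < c₀) (hc1 : c₀ ≤ 1) (hh : Φ.HasHoles hℓ q c₀) :
    ∃ η > 0, ∃ c > 0, ∀ (x : EuclideanSpace ℝ (Fin d)) (r : ℝ), 0 < r → r ≤ 1 → ∀ a : ℝ,
      ∃ a', a ≤ a' ∧ a' + c * r ≤ a + r ∧ ∀ z ∈ K,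
        (∀ j : Fin d, j.val < ℓ → |x j - z j| ≤ η * r) → z ⟨ℓ, hℓ⟩ ∉ Ioo a' (a' + c * r) := by
  classical
  have hq0 : ∀ k, 0 < q k := fun k => hρ.trans_le (hρq k)
  set M := (Finset.univ : Finset (Fin d → Bool)).card with hM
  have hcM : 0 < c₀ ^ M := by positivity
  have hcM1 : c₀ ^ M ≤ 1 := pow_le_one₀ hc0.le hc1
  refine ⟨ρ * c₀ ^ M / 5, by positivity, c₀ ^ M, hcM, fun x r hr0 hr1 a => ?_⟩
  set s := c₀ ^ M * r with hs
  have hs0 : 0 < s := by positivity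
  have hs1 : s ≤ 1 := mul_le_one₀ hcM1 hr0.le hr1
  set h := ρ * s / 5 with hh'
  have hh0 : 0 < h := by positivity
  have e : ρ * c₀ ^ M / 5 * r = h := by rw [hh', hs]; ring
  rw [e]
  -- Each sign pattern τ marks a corner x ± 2h. Stopped words whose open base boxes contain the same
  -- corner are not separated, hence agree, so there are at most 2^d classes.
  let S : (Fin d → Bool) → Set (List (Fin N)) := fun τ =>
    {w | IsStopped q s w ∧ ∀ j : Fin d, j.val < ℓ →
      (if τ j then x j - 2 * h else x j + 2 * h) ∈
        Ioo (Φ.wordShift w j) (Φ.wordShift w j + Φ.wordRatio w j)}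
  obtain ⟨a', h1, h2, h3⟩ := hh.exists_common hc0 hc1 S (fun τ w hw w' hw' => by
    rcases hw.1.forall₂_or_separated hsep hcube hℓ.le hqa hw'.1 with hf | ⟨j, hj, hsj⟩
    · exact hf
    · have p1 := hw.2 j hj
      have p2 := hw'.2 j hj
      rcases hsj with hsj | hsj <;> linarith [p1.1, p1.2, p2.1, p2.2])
    Finset.univ hr0 hr1 a (fun τ w hw => hw.1.prod_le hq0)
  refine ⟨a', h1, h2, fun z hz hxz hza => ?_⟩
  obtain ⟨w, hw, hwz⟩ := exists_isStopped hK hpre hq0 hq1 hs0 hz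
  have hlen : ρ * s ≤ (w.map q).prod := hw.le_prod hρ hρq (mul_le_one₀ hρ1 hs0.le hs1)
  -- A base side has length at least ρs = 5h and meets [x j - h, x j + h], so its interior contains
  -- x j - 2h or x j + 2h.
  refine h3 (fun j => decide (Φ.wordShift w j < x j - 2 * h)) (Finset.mem_univ _) w
    ⟨hw, fun j hj => ?_⟩ _ hza (hwz _)
  have hl : ρ * s ≤ Φ.wordRatio w j :=
    hlen.trans (le_wordRatio (fun k => (hq0 k).le) (fun k => hqr k j hj) w)
  have h5 : 5 * h = ρ * s := by rw [hh']; ring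
  have hzj := hwz j
  have habs := abs_le.1 (hxz j hj)
  have z1 := hzj.1
  have z2 := hzj.2
  by_cases hlt : Φ.wordShift w j < x j - 2 * h
  · simp only [hlt, decide_true, if_true]
    exact ⟨hlt, by linarith [habs.2]⟩
  · simp only [hlt, decide_false]
    constructor
    · simp only [Bool.false_eq_true, if_false]; linarith [habs.1]
    · simp only [Bool.false_eq_true, if_false]; linarith [habs.1]

/-! ### Confinement of chains -/

/-- The chain relation in `K`, at scale `ε` in the first `ℓ` coordinates. -/
def Step (K : Set (EuclideanSpace ℝ (Fin d))) (ℓ : ℕ) (ε : ℝ)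
    (x y : EuclideanSpace ℝ (Fin d)) : Prop :=
  y ∈ K ∧ ∀ j : Fin d, j.val < ℓ → |x j - y j| ≤ ε

/-- Chains in the first `ℓ` coordinates with steps at most `δ r` do not move farther than `r`. -/
def ChainBound (K : Set (EuclideanSpace ℝ (Fin d))) (ℓ : ℕ) : Prop :=
  ∃ δ > 0, ∀ r, 0 < r → ∀ x ∈ K, ∀ y, Relation.ReflTransGen (Step K ℓ (δ * r)) x y →
    ∀ j : Fin d, j.val < ℓ → |x j - y j| ≤ r

theorem ChainBound.succ {K : Set (EuclideanSpace ℝ (Fin d))}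
    (hK : ∀ x ∈ K, ∀ i, x i ∈ Icc (0 : ℝ) 1) {ℓ : ℕ} (hℓ : ℓ < d) (h : ChainBound K ℓ)
    {η c : ℝ} (hη : 0 < η) (hc : 0 < c)
    (hole : ∀ (x : EuclideanSpace ℝ (Fin d)) (r : ℝ), 0 < r → r ≤ 1 → ∀ a : ℝ,
      ∃ a', a ≤ a' ∧ a' + c * r ≤ a + r ∧ ∀ z ∈ K,
        (∀ j : Fin d, j.val < ℓ → |x j - z j| ≤ η * r) → z ⟨ℓ, hℓ⟩ ∉ Ioo a' (a' + c * r)) :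
    ChainBound K (ℓ + 1) := by
  obtain ⟨δ, hδ, h⟩ := h
  set η' := min η 1 with hη'
  have hη0 : 0 < η' := lt_min hη one_pos
  refine ⟨min (δ * η') (c / 2), by positivity, fun r hr x hx y hxy => ?_⟩
  have hyK : ∀ y, Relation.ReflTransGen (Step K (ℓ + 1) (min (δ * η') (c / 2) * r)) x y →
      y ∈ K := by
    intro y hy
    cases hy with
    | refl => exact hx
    | tail _ h => exact h.1
  rcases le_total 1 r with h1 | h1
  · intro j _
    have a1 := hK x hx j
    have a2 := hK y (hyK y hxy) j
    rw [abs_le]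
    constructor <;> linarith [a1.1, a1.2, a2.1, a2.2]
  have hbase : ∀ y, Relation.ReflTransGen (Step K (ℓ + 1) (min (δ * η') (c / 2) * r)) x y →
      ∀ j : Fin d, j.val < ℓ → |x j - y j| ≤ η' * r := by
    intro y hy
    refine h (η' * r) (by positivity) x hx y (Relation.ReflTransGen.mono (fun u v huv => ⟨huv.1, fun j hj => ?_⟩) _ _ hy)
    refine (huv.2 j (hj.trans (Nat.lt_succ_self ℓ))).trans ?_
    rw [← mul_assoc]
    exact mul_le_mul_of_nonneg_right (min_le_left _ _) hr.le
  have hnear : ∀ y, Relation.ReflTransGen (Step K (ℓ + 1) (min (δ * η') (c / 2) * r)) x y →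
      ∀ j : Fin d, j.val < ℓ → |x j - y j| ≤ η * r := fun y hy j hj =>
    (hbase y hy j hj).trans (mul_le_mul_of_nonneg_right (min_le_left _ _) hr.le)
  set i : Fin d := ⟨ℓ, hℓ⟩ with hi
  obtain ⟨a, ha1, ha2, ha3⟩ := hole x r hr h1 (x i)
  -- One hole on each side of x i, within distance r: steps of at most half a hole's length cannot
  -- cross either.
  obtain ⟨b, hb1, hb2, hb3⟩ := hole x r hr h1 (x i - r)
  have hcr : 0 < c * r := by positivity
  have hmain : y i ≤ a ∧ b + c * r ≤ y i := by
    induction hxy with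
    | refl => exact ⟨ha1, by linarith⟩
    | @tail u v hu huv ih =>
      have hv := hu.tail huv
      have hstep := huv.2 i (Nat.lt_succ_self ℓ)
      have hsm : min (δ * η') (c / 2) * r ≤ c * r / 2 :=
        (mul_le_mul_of_nonneg_right (min_le_right _ _) hr.le).trans (by linarith)
      have habs := abs_le.1 (hstep.trans hsm)
      have g1 := ha3 v huv.1 (hnear v hv)
      have g2 := hb3 v huv.1 (hnear v hv)
      simp only [mem_Ioo, not_and_or, not_lt] at g1 g2
      constructor
      · rcases g1 with g1 | g1
        · exact g1
        · linarith [habs.1]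
      · rcases g2 with g2 | g2
        · linarith [habs.2]
        · exact g2
  intro j hj
  rcases Nat.lt_succ_iff_lt_or_eq.1 hj with hj | hj
  · exact (hbase y hxy j hj).trans (mul_le_of_le_one_left hr.le (min_le_right _ _))
  · obtain rfl : j = i := Fin.ext hj
    rw [abs_le]
    constructor <;> linarith [hmain.1, hmain.2]

namespace IsLalleyGatzourasSponge

variable {Φ : DiagonalIFS d N} {K : Set (EuclideanSpace ℝ (Fin d))}

theorem diagMap_mem (hK : Φ.IsLalleyGatzourasSponge K) (k : Fin N) {z : EuclideanSpace ℝ (Fin d)}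
    (hz : z ∈ K) : diagMap (Φ.ratio k) (Φ.shift k) z ∈ K := by
  rw [hK.isAttractor.eq_biUnion]
  exact mem_biUnion (mem_range_self k) (mem_image_of_mem _ hz)

theorem exists_preimage (hK : Φ.IsLalleyGatzourasSponge K) :
    ∀ z ∈ K, ∃ k, ∃ z' ∈ K, ∀ j, z j = Φ.ratio k j * z' j + Φ.shift k j := by
  intro z hz
  rw [hK.isAttractor.eq_biUnion] at hz
  obtain ⟨f, ⟨k, rfl⟩, z', hz', rfl⟩ := mem_iUnion₂.1 hz
  exact ⟨k, z', hz', fun j => rfl⟩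

/-- Compare an extremal point of `K` in direction j with its image under `φ_k`. -/
theorem preservesCube (hK : Φ.IsLalleyGatzourasSponge K) : Φ.PreservesCube := by
  intro k j
  have hcont : ContinuousOn (fun z : EuclideanSpace ℝ (Fin d) => z j) K := by fun_prop
  have h1 := Φ.ratio_lt_one k j
  constructor
  · obtain ⟨z, hz, hmin⟩ := hK.isAttractor.isCompact.exists_isMinOn hK.isAttractor.nonempty hcont
    have h2 : z j ≤ Φ.ratio k j * z j + Φ.shift k j := hmin (hK.diagMap_mem k hz)
    nlinarith [(hK.subset_cube z hz j).1]
  · obtain ⟨z, hz, hmax⟩ := hK.isAttractor.isCompact.exists_isMaxOn hK.isAttractor.nonempty hcont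
    have h2 : Φ.ratio k j * z j + Φ.shift k j ≤ z j := hmax (hK.diagMap_mem k hz)
    nlinarith [(hK.subset_cube z hz j).2]

end IsLalleyGatzourasSponge

/-! ### Fiber IFSs, gaps and weights -/

/-- The first `ℓ` coordinates of `φ_k`. -/
def projMap (Φ : DiagonalIFS d N) (ℓ : ℕ) (hℓ : ℓ ≤ d) (k : Fin N) :
    EuclideanSpace ℝ (Fin ℓ) → EuclideanSpace ℝ (Fin ℓ) :=
  diagMap (fun i => Φ.ratio k (Fin.castLE hℓ i)) (fun i => Φ.shift k (Fin.castLE hℓ i))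

theorem pairMap_projMap (Φ : DiagonalIFS d N) {ℓ : ℕ} (hℓ : ℓ < d) {k k' : Fin N}
    (h : Φ.Agree ℓ k k') : pairMap (Φ.projMap ℓ hℓ.le k)
      (fun t => Φ.ratio k' ⟨ℓ, hℓ⟩ * t + Φ.shift k' ⟨ℓ, hℓ⟩) = Φ.projMap (ℓ + 1) hℓ k' := by
  funext x
  ext i
  refine Fin.lastCases ?_ (fun i => ?_) i
  · simp [pairMap, projMap, diagMap]
    rfl
  · obtain ⟨h1, h2⟩ := h (i.castLE hℓ.le) i.isLt
    simp only [pairMap, projMap, diagMap, Fin.snoc_castSucc, majorProj]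
    rw [h1, h2]
    rfl

theorem mem_fiberIFS_iff (Φ : DiagonalIFS d N) {ℓ : ℕ} (hℓ : ℓ < d) (k : Fin N) (f : ℝ → ℝ) :
    f ∈ Φ.fiberIFS ℓ hℓ (Φ.projMap ℓ hℓ.le k) ↔ ∃ k', Φ.Agree ℓ k k' ∧
      f = fun t => Φ.ratio k' ⟨ℓ, hℓ⟩ * t + Φ.shift k' ⟨ℓ, hℓ⟩ := by
  constructor
  · rintro ⟨k', hk'⟩
    have hval := fun (x : EuclideanSpace ℝ (Fin (ℓ + 1))) i =>
      congrArg (fun y : EuclideanSpace ℝ (Fin (ℓ + 1)) => y i) (congrFun hk' x)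
    have hcoord : Φ.projMap ℓ hℓ.le k = Φ.projMap ℓ hℓ.le k' := by
      funext y
      ext i
      have := hval (WithLp.toLp 2 (Fin.snoc (α := fun _ => ℝ) (fun i => y i) 0)) i.castSucc
      simp only [pairMap, diagMap, Fin.snoc_castSucc] at this
      have e : majorProj (Nat.le_succ ℓ) (WithLp.toLp 2 (Fin.snoc (α := fun _ => ℝ)
          (fun i => y i) 0)) = y := by
        ext i
        exact Fin.snoc_castSucc (α := fun _ => ℝ) _ _ _
      rw [e] at this
      exact this.symm
    obtain ⟨h1, h2⟩ := diagMap_injective hcoord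
    refine ⟨k', fun j hj => ⟨congrFun h1 ⟨j, hj⟩, congrFun h2 ⟨j, hj⟩⟩, ?_⟩
    funext t
    have := hval (WithLp.toLp 2 (Fin.snoc (α := fun _ => ℝ) (fun _ => 0) t)) (Fin.last ℓ)
    simp only [pairMap, diagMap, Fin.snoc_last] at this
    exact this.symm
  · rintro ⟨k', hk', rfl⟩
    exact ⟨k', (Φ.pairMap_projMap hℓ hk').symm⟩

theorem isClosed_iUnion_fiber (Φ : DiagonalIFS d N) {ℓ : ℕ} (i : Fin d) (k : Fin N) :
    IsClosed {y | ∃ k', Φ.Agree ℓ k k' ∧ y ∈ Icc (Φ.shift k' i) (Φ.shift k' i + Φ.ratio k' i)} := by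
  have : {y | ∃ k', Φ.Agree ℓ k k' ∧ y ∈ Icc (Φ.shift k' i) (Φ.shift k' i + Φ.ratio k' i)} =
      ⋃ k' ∈ {k' | Φ.Agree ℓ k k'}, Icc (Φ.shift k' i) (Φ.shift k' i + Φ.ratio k' i) := by
    ext y
    simp only [mem_ofPred_eq, mem_iUnion, exists_prop]
  rw [this]
  exact (Set.toFinite _).isClosed_biUnion fun _ _ => isClosed_Icc

theorem exists_fiber_gap {Φ : DiagonalIFS d N} (hcube : Φ.PreservesCube) {ℓ : ℕ} (hℓ : ℓ < d)
    (k : Fin N)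
    (h : ¬ IsAttractor (Φ.fiberIFS ℓ hℓ (Φ.projMap ℓ hℓ.le k)) (Icc (0 : ℝ) 1)) :
    ∃ g > 0, ∃ a, 0 ≤ a ∧ a + g ≤ 1 ∧ ∀ k', Φ.Agree ℓ k k' → ∀ y ∈ Ioo a (a + g),
      y ∉ Icc (Φ.shift k' ⟨ℓ, hℓ⟩) (Φ.shift k' ⟨ℓ, hℓ⟩ + Φ.ratio k' ⟨ℓ, hℓ⟩) := by
  obtain ⟨y, hy, hyn⟩ : ∃ y ∈ Icc (0 : ℝ) 1, ¬ ∃ k', Φ.Agree ℓ k k' ∧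
      y ∈ Icc (Φ.shift k' ⟨ℓ, hℓ⟩) (Φ.shift k' ⟨ℓ, hℓ⟩ + Φ.ratio k' ⟨ℓ, hℓ⟩) := by
    by_contra! hcon
    refine h ⟨⟨0, by simp⟩, isCompact_Icc, Subset.antisymm (fun y hy => ?_) ?_⟩
    · obtain ⟨k', hk', hyk⟩ := hcon y hy
      have hp := Φ.ratio_pos k' ⟨ℓ, hℓ⟩
      refine mem_biUnion ((Φ.mem_fiberIFS_iff hℓ k _).2 ⟨k', hk', rfl⟩)
        ⟨(y - Φ.shift k' ⟨ℓ, hℓ⟩) / Φ.ratio k' ⟨ℓ, hℓ⟩, ⟨?_, ?_⟩, ?_⟩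
      · exact div_nonneg (by linarith [hyk.1]) hp.le
      · rw [div_le_one hp]; linarith [hyk.2]
      · simp only
        field_simp
        ring
    · refine iUnion₂_subset fun f hf => ?_
      obtain ⟨k', -, rfl⟩ := (Φ.mem_fiberIFS_iff hℓ k f).1 hf
      rintro _ ⟨t, ht, rfl⟩
      obtain ⟨h1, h2⟩ := hcube k' ⟨ℓ, hℓ⟩
      have hp := Φ.ratio_pos k' ⟨ℓ, hℓ⟩
      constructor
      · have := mul_nonneg hp.le ht.1
        simp only; linarith
      · have := mul_le_of_le_one_right hp.le ht.2
        simp only; linarith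
  obtain ⟨ε, hε, hball⟩ := Metric.isOpen_iff.1
    (Φ.isClosed_iUnion_fiber (ℓ := ℓ) ⟨ℓ, hℓ⟩ k).isOpen_compl y hyn
  rw [Real.ball_eq_Ioo] at hball
  have key : ∀ z ∈ Ioo (y - ε) (y + ε), ∀ k', Φ.Agree ℓ k k' →
      z ∉ Icc (Φ.shift k' ⟨ℓ, hℓ⟩) (Φ.shift k' ⟨ℓ, hℓ⟩ + Φ.ratio k' ⟨ℓ, hℓ⟩) :=
    fun z hz k' hk' hzk => hball hz ⟨k', hk', hzk⟩
  -- The cap 1/2 lets the gap fit in [0,1] on the side of y that has more room.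
  refine ⟨min ε (1 / 2), by positivity, ?_⟩
  have m1 := min_le_left ε (1 / 2)
  have m2 := min_le_right ε (1 / 2)
  rcases le_total y (1 / 2) with hy2 | hy2
  · exact ⟨y, hy.1, by linarith, fun k' hk' z hz =>
      key z ⟨by linarith [hz.1], by linarith [hz.2]⟩ k' hk'⟩
  · exact ⟨y - min ε (1 / 2), by linarith, by linarith [hy.2], fun k' hk' z hz =>
      key z ⟨by linarith [hz.1], by linarith [hz.2]⟩ k' hk'⟩

/-- Take the largest ratio in direction ℓ over the class of k: the ratios below ℓ are constant on
the class and, by the coordinate ordering, exceed it. -/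
theorem exists_weight {Φ : DiagonalIFS d N} (hord : Φ.CoordinateOrdering) {ℓ : ℕ} (hℓ : ℓ < d) :
    ∃ q : Fin N → ℝ, (∀ k k', Φ.Agree ℓ k k' → q k = q k') ∧ (∀ k, Φ.ratio k ⟨ℓ, hℓ⟩ ≤ q k) ∧
      (∀ k, q k < 1) ∧ ∀ k, ∀ j : Fin d, j.val < ℓ → q k ≤ Φ.ratio k j := by
  classical
  have hne : ∀ k, (Finset.univ.filter fun k' => Φ.Agree ℓ k k').Nonempty := fun k =>
    ⟨k, by simpa using Agree.refl Φ ℓ k⟩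
  refine ⟨fun k => (Finset.univ.filter fun k' => Φ.Agree ℓ k k').sup' (hne k)
    fun k' => Φ.ratio k' ⟨ℓ, hℓ⟩, fun k k' h => ?_, fun k => ?_, fun k => ?_, fun k j hj => ?_⟩
  · have : (Finset.univ.filter fun k'' => Φ.Agree ℓ k k'') =
        Finset.univ.filter fun k'' => Φ.Agree ℓ k' k'' := by
      ext k''
      simpa using ⟨fun h' => h.symm.trans h', fun h' => h.trans h'⟩
    simp only [this]
  · exact Finset.le_sup' (fun k' => Φ.ratio k' ⟨ℓ, hℓ⟩) (by simpa using Agree.refl Φ ℓ k)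
  · exact (Finset.sup'_lt_iff _).2 fun k' _ => Φ.ratio_lt_one _ _
  · refine Finset.sup'_le _ _ fun k' hk' => ?_
    rw [((Finset.mem_filter.1 hk').2 j hj).1]
    exact (hord k' (show j < ⟨ℓ, hℓ⟩ from hj)).le

theorem IsLalleyGatzourasSponge.chainBound {Φ : DiagonalIFS d N}
    {K : Set (EuclideanSpace ℝ (Fin d))} (hK : Φ.IsLalleyGatzourasSponge K)
    (h : ∀ (ℓ : ℕ) (hℓ : ℓ < d), ∀ u ∈ Φ.projMaps ℓ hℓ.le,
      ¬ IsAttractor (Φ.fiberIFS ℓ hℓ u) (Icc (0 : ℝ) 1)) (ℓ : ℕ) (hℓ : ℓ ≤ d) :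
    ChainBound K ℓ := by
  induction ℓ with
  | zero => exact ⟨1, one_pos, fun r _ x _ y _ j hj => absurd hj (Nat.not_lt_zero _)⟩
  | succ ℓ ih =>
    have hsep := hK.neatProjection.separated
    have hcube := hK.preservesCube
    obtain ⟨q, hqa, hqr, hq1, hqj⟩ := exists_weight hK.coordinateOrdering hℓ
    obtain ⟨ρ, hρ, hρr⟩ := exists_pos_le_of_finite (fun k => Φ.ratio k ⟨ℓ, hℓ⟩)
      fun k => Φ.ratio_pos k _
    obtain ⟨z, hz⟩ := hK.isAttractor.nonempty
    obtain ⟨k₀, -⟩ := hK.exists_preimage z hz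
    have hρ1 : ρ ≤ 1 := (hρr k₀).trans (Φ.ratio_lt_one _ _).le
    choose g hg a ha0 ha1 ha using fun k =>
      exists_fiber_gap hcube hℓ k (h ℓ hℓ _ ⟨k, rfl⟩)
    obtain ⟨γ, hγ, hγg⟩ := exists_pos_le_of_finite g hg
    obtain ⟨c₀, hc0, hc1, hh⟩ := exists_hasHoles hsep hcube hℓ hqr hqa hρ hρ1 hρr hγ fun k =>
      ⟨a k, ha0 k, by linarith [ha1 k, hγg k], fun k' hk' y hy =>
        ha k k' hk' y ⟨hy.1, by linarith [hy.2, hγg k]⟩⟩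
    obtain ⟨η, hη, c, hc, hole⟩ := exists_fiber_hole hsep hcube hK.subset_cube
      hK.exists_preimage hℓ hqa hqj hρ hρ1 (fun k => (hρr k).trans (hqr k)) hq1 hc0 hc1 hh
    exact (ih (Nat.le_of_succ_le hℓ)).succ hK.subset_cube hℓ hη hc hole

/-! ### From chain bounds to disconnectedness -/

theorem dist_le_of_abs_le {x y : EuclideanSpace ℝ (Fin d)} {ε : ℝ} (h : ∀ j, |x j - y j| ≤ ε) :
    dist x y ≤ d * ε := by
  have h1 : dist x y ≤ ∑ j, |x j - y j| := by
    rw [EuclideanSpace.dist_eq]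
    simp only [Real.dist_eq]
    rw [Real.sqrt_le_left (Finset.sum_nonneg fun _ _ => abs_nonneg _)]
    exact Finset.sum_sq_le_sq_sum_of_nonneg fun _ _ => abs_nonneg _
  refine h1.trans ((Finset.sum_le_sum fun j _ => h j).trans ?_)
  simp

theorem abs_coord_le_dist (x y : EuclideanSpace ℝ (Fin d)) (j : Fin d) :
    |x j - y j| ≤ dist x y := by
  rw [dist_eq_norm]
  simpa using PiLp.norm_apply_le (x - y) j

theorem ChainBound.uniformlyDisconnected (hd : 1 ≤ d) {K : Set (EuclideanSpace ℝ (Fin d))}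
    (h : ChainBound K d) : UniformlyDisconnected K := by
  obtain ⟨δ, hδ, h⟩ := h
  have hd' : (0 : ℝ) < d := by exact_mod_cast hd
  -- With r = D / (2d), coordinatewise confinement gives D ≤ d * r = D / 2, a contradiction.
  refine ⟨δ / (2 * d), by positivity, ?_⟩
  rintro ⟨n, x, hn, hx, hstep⟩
  have hne : x 0 ≠ x (Fin.last n) := fun heq => by
    have := congrArg Fin.val (hx heq)
    simp at this
    omega
  set D := dist (x 0) (x (Fin.last n)) with hD
  have hD0 : 0 < D := dist_pos.2 hne
  have hr : 0 < D / (2 * d) := by positivity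
  have hchain : ∀ i : Fin (n + 1),
      Relation.ReflTransGen (Step K d (δ * (D / (2 * d)))) (x 0 : EuclideanSpace ℝ (Fin d)) (x i) := by
    intro i
    induction i using Fin.induction with
    | zero => exact .refl
    | succ i ih =>
      refine ih.tail ⟨(x i.succ).2, fun j _ => (abs_coord_le_dist _ _ j).trans ?_⟩
      have := hstep i
      rw [Subtype.dist_eq] at this
      refine this.trans (le_of_eq ?_)
      ring
  have := dist_le_of_abs_le fun j => h _ hr _ (x 0).2 _ (hchain (Fin.last n)) j j.isLt
  rw [← Subtype.dist_eq, ← hD] at this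
  have e : (d : ℝ) * (D / (2 * d)) = D / 2 := by field_simp
  linarith

/-- A preconnected set joins any two of its points by chains with arbitrarily small steps; these
lift to `K`. -/
theorem ChainBound.isTotallyDisconnected {K : Set (EuclideanSpace ℝ (Fin d))} {ℓ : ℕ}
    (hℓ : ℓ ≤ d) (h : ChainBound K ℓ) : IsTotallyDisconnected (majorProj hℓ '' K) := by
  obtain ⟨δ, hδ, h⟩ := h
  intro S hSK hS x hx y hy
  ext j
  have hall : ∀ r > 0, |x j - y j| ≤ r := by
    intro r hr
    have hε : 0 < δ * r := by positivity
    have : Relation.ReflTransGen (fun u v : EuclideanSpace ℝ (Fin ℓ) =>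
        u ∈ S ∧ v ∈ S ∧ dist u v < δ * r) x y := by
      refine hS.induction₂' _ (fun u hu => ?_) (fun _ _ _ _ _ _ => .trans) hx hy
      filter_upwards [self_mem_nhdsWithin, mem_nhdsWithin_of_mem_nhds (Metric.ball_mem_nhds u hε)]
        with v hv hv'
      exact ⟨.single ⟨hu, hv, by rw [dist_comm]; exact hv'⟩, .single ⟨hv, hu, hv'⟩⟩
    obtain ⟨x', hx', rfl⟩ := hSK hx
    have hlift : ∃ y' ∈ K, majorProj hℓ y' = y ∧
        Relation.ReflTransGen (Step K ℓ (δ * r)) x' y' := by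
      clear hy
      induction this with
      | refl => exact ⟨x', hx', rfl, .refl⟩
      | @tail u v _ huv ih =>
        obtain ⟨u', hu', rfl, hch⟩ := ih
        obtain ⟨v', hv', rfl⟩ := hSK huv.2.1
        exact ⟨v', hv', rfl, hch.tail ⟨hv', fun i hi =>
          (abs_coord_le_dist (majorProj hℓ u') (majorProj hℓ v') ⟨i, hi⟩).trans huv.2.2.le⟩⟩
    obtain ⟨y', hy', rfl, hch⟩ := hlift
    exact h r hr x' hx' y' hch (j.castLE hℓ) j.isLt
  have : |x j - y j| ≤ 0 := le_of_forall_pos_le_add fun r hr => by linarith [hall r hr]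
  exact sub_eq_zero.1 (abs_nonpos_iff.1 this)

/-! ### Consequences of a full fiber IFS -/

/-- If the fiber IFS of `φ_k` is full, then the fiber of `K` over the fixed point of the
projection of `φ_k` projects onto `[0, 1]`. -/
theorem IsLalleyGatzourasSponge.exists_mem_fiber {Φ : DiagonalIFS d N}
    {K : Set (EuclideanSpace ℝ (Fin d))} (hK : Φ.IsLalleyGatzourasSponge K) {ℓ : ℕ} (hℓ : ℓ < d)
    (k : Fin N) (h : IsAttractor (Φ.fiberIFS ℓ hℓ (Φ.projMap ℓ hℓ.le k)) (Icc (0 : ℝ) 1))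
    {t : ℝ} (ht : t ∈ Icc (0 : ℝ) 1) :
    ∃ z ∈ K, (∀ j : Fin d, j.val < ℓ → z j = Φ.shift k j / (1 - Φ.ratio k j)) ∧
      z ⟨ℓ, hℓ⟩ = t := by
  obtain ⟨c, hc0, hc⟩ := exists_pos_le_of_finite
    (fun p : Fin N × Fin d => 1 - Φ.ratio p.1 p.2) fun p => by
      linarith [Φ.ratio_lt_one p.1 p.2]
  have hrat : ∀ k j, Φ.ratio k j ≤ 1 - c := fun k j => by linarith [hc (k, j)]
  have hc1 : 0 ≤ 1 - c := (Φ.ratio_pos k ⟨ℓ, hℓ⟩).le.trans (hrat _ _)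
  have hcube := hK.preservesCube
  have happ : ∀ n : ℕ, ∀ t ∈ Icc (0 : ℝ) 1, ∃ z ∈ K,
      (∀ j : Fin d, j.val < ℓ → |z j - Φ.shift k j / (1 - Φ.ratio k j)| ≤ (1 - c) ^ n) ∧
        |z ⟨ℓ, hℓ⟩ - t| ≤ (1 - c) ^ n := by
    intro n
    induction n with
    | zero =>
      intro t ht
      obtain ⟨z, hz⟩ := hK.isAttractor.nonempty
      refine ⟨z, hz, fun j _ => ?_, ?_⟩
      · have h1 := hK.subset_cube z hz j
        have h2 := hcube k j
        have h3 : 0 < 1 - Φ.ratio k j := by linarith [Φ.ratio_lt_one k j]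
        have h4 := div_nonneg h2.1 h3.le
        have h5 : Φ.shift k j / (1 - Φ.ratio k j) ≤ 1 := by rw [div_le_one h3]; linarith
        rw [pow_zero, abs_le]
        constructor <;> linarith [h1.1, h1.2]
      · have h1 := hK.subset_cube z hz ⟨ℓ, hℓ⟩
        rw [pow_zero, abs_le]
        constructor <;> linarith [h1.1, h1.2, ht.1, ht.2]
    | succ n ih =>
      intro t ht
      rw [h.eq_biUnion] at ht
      obtain ⟨f, hf, s, hs, rfl⟩ := mem_iUnion₂.1 ht
      obtain ⟨k', hk', rfl⟩ := (Φ.mem_fiberIFS_iff hℓ k f).1 hf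
      obtain ⟨z, hz, h1, h2⟩ := ih s hs
      refine ⟨_, hK.diagMap_mem k' hz, fun j hj => ?_, ?_⟩
      · have h3 : 1 - Φ.ratio k' j ≠ 0 := by linarith [Φ.ratio_lt_one k' j]
        have h4 := h1 j hj
        rw [(hk' j hj).1, (hk' j hj).2] at h4 ⊢
        have e : diagMap (Φ.ratio k') (Φ.shift k') z j - Φ.shift k' j / (1 - Φ.ratio k' j) =
            Φ.ratio k' j * (z j - Φ.shift k' j / (1 - Φ.ratio k' j)) := by
          simp only [diagMap]
          field_simp
          ring
        rw [e, abs_mul, abs_of_pos (Φ.ratio_pos k' j), pow_succ']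
        exact mul_le_mul (hrat _ _) h4 (abs_nonneg _) hc1
      · have e : diagMap (Φ.ratio k') (Φ.shift k') z ⟨ℓ, hℓ⟩ -
            (Φ.ratio k' ⟨ℓ, hℓ⟩ * s + Φ.shift k' ⟨ℓ, hℓ⟩) =
            Φ.ratio k' ⟨ℓ, hℓ⟩ * (z ⟨ℓ, hℓ⟩ - s) := by
          simp only [diagMap]
          ring
        rw [e, abs_mul, abs_of_pos (Φ.ratio_pos k' _), pow_succ']
        exact mul_le_mul (hrat _ _) h2 (abs_nonneg _) hc1
  -- F measures the failure of the required equations; approximate solutions make its minimum over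
  -- the compact `K` zero.
  let F : EuclideanSpace ℝ (Fin d) → ℝ := fun z =>
    ∑ j : Fin d, (if j.val < ℓ then |z j - Φ.shift k j / (1 - Φ.ratio k j)| else 0) +
      |z ⟨ℓ, hℓ⟩ - t|
  have hF : Continuous F := by
    refine Continuous.add (continuous_finsetSum _ fun j _ => ?_) (by fun_prop)
    split_ifs <;> fun_prop
  obtain ⟨z, hz, hmin⟩ := hK.isAttractor.isCompact.exists_isMinOn hK.isAttractor.nonempty
    hF.continuousOn
  have hnn : ∀ j : Fin d, 0 ≤ if j.val < ℓ then |z j - Φ.shift k j / (1 - Φ.ratio k j)| else 0 :=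
    fun j => by split_ifs <;> positivity
  have hle : ∀ n : ℕ, F z ≤ (d + 1) * (1 - c) ^ n := by
    intro n
    obtain ⟨y, hy, h1, h2⟩ := happ n t ht
    refine (hmin hy).trans ?_
    have : ∑ j : Fin d, (if j.val < ℓ then |y j - Φ.shift k j / (1 - Φ.ratio k j)| else 0) ≤
        ∑ _j : Fin d, (1 - c) ^ n := Finset.sum_le_sum fun j _ => by
      split_ifs with hj
      · exact h1 j hj
      · exact pow_nonneg hc1 n
    simp only [Finset.sum_const, Finset.card_univ, Fintype.card_fin, nsmul_eq_mul] at this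
    show ∑ j : Fin d, (if j.val < ℓ then |y j - Φ.shift k j / (1 - Φ.ratio k j)| else 0) +
      |y ⟨ℓ, hℓ⟩ - t| ≤ _
    linarith
  have hF0 : F z ≤ 0 := by
    have hlim := (tendsto_pow_atTop_nhds_zero_of_lt_one hc1 (by linarith : 1 - c < 1)).const_mul
      ((d : ℝ) + 1)
    rw [mul_zero] at hlim
    exact ge_of_tendsto' hlim hle
  have hsum := Finset.sum_nonneg fun j (_ : j ∈ Finset.univ) => hnn j
  have hab := abs_nonneg (z ⟨ℓ, hℓ⟩ - t)
  refine ⟨z, hz, fun j hj => ?_, ?_⟩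
  · have h1 := Finset.single_le_sum (fun j _ => hnn j) (Finset.mem_univ j)
    simp only [hj, if_true] at h1
    have : |z j - Φ.shift k j / (1 - Φ.ratio k j)| ≤ 0 := by
      have : F z = _ + _ := rfl
      linarith
    exact sub_eq_zero.1 (abs_nonpos_iff.1 this)
  · have : |z ⟨ℓ, hℓ⟩ - t| ≤ 0 := by
      have : F z = _ + _ := rfl
      linarith
    exact sub_eq_zero.1 (abs_nonpos_iff.1 this)

theorem IsLalleyGatzourasSponge.not_isTotallyDisconnected {Φ : DiagonalIFS d N}
    {K : Set (EuclideanSpace ℝ (Fin d))} (hK : Φ.IsLalleyGatzourasSponge K) {ℓ : ℕ} (hℓ : ℓ < d)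
    (k : Fin N) (h : IsAttractor (Φ.fiberIFS ℓ hℓ (Φ.projMap ℓ hℓ.le k)) (Icc (0 : ℝ) 1)) :
    ¬ IsTotallyDisconnected (majorProj (Nat.succ_le_of_lt hℓ) '' K) := by
  intro htd
  let p : Fin ℓ → ℝ := fun i =>
    Φ.shift k (i.castLE hℓ.le) / (1 - Φ.ratio k (i.castLE hℓ.le))
  let γ : ℝ → EuclideanSpace ℝ (Fin (ℓ + 1)) := fun t =>
    WithLp.toLp 2 (Fin.snoc (α := fun _ => ℝ) p t)
  have hγ : Continuous γ := by
    refine (PiLp.continuous_toLp 2 _).comp (continuous_pi fun i => ?_)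
    refine Fin.lastCases ?_ (fun i => ?_) i
    · simpa using continuous_id'
    · simpa using continuous_const
  have hsub : γ '' Icc 0 1 ⊆ majorProj (Nat.succ_le_of_lt hℓ) '' K := by
    rintro _ ⟨t, ht, rfl⟩
    obtain ⟨z, hz, h1, h2⟩ := hK.exists_mem_fiber hℓ k h ht
    refine ⟨z, hz, ?_⟩
    ext i
    refine Fin.lastCases ?_ (fun i => ?_) i
    · simp only [γ, majorProj, Fin.snoc_last]
      exact h2
    · simpa [γ, majorProj, p] using h1 (i.castLE hℓ.le) i.isLt
  have := htd _ hsub (isPreconnected_Icc.image γ hγ.continuousOn)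
    (mem_image_of_mem γ (left_mem_Icc.2 zero_le_one))
    (mem_image_of_mem γ (right_mem_Icc.2 zero_le_one))
  have := congrArg (fun y : EuclideanSpace ℝ (Fin (ℓ + 1)) => y (Fin.last ℓ)) this
  simp [γ] at this

theorem IsLalleyGatzourasSponge.iterate_mem {Φ : DiagonalIFS d N}
    {K : Set (EuclideanSpace ℝ (Fin d))} (hK : Φ.IsLalleyGatzourasSponge K) (k : Fin N) (n : ℕ)
    {z : EuclideanSpace ℝ (Fin d)} (hz : z ∈ K) :
    (diagMap (Φ.ratio k) (Φ.shift k))^[n] z ∈ K := by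
  induction n with
  | zero => exact hz
  | succ n ih =>
    rw [Function.iterate_succ_apply']
    exact hK.diagMap_mem k ih

theorem iterate_diagMap_sub (a b : Fin d → ℝ) (n : ℕ) (y z : EuclideanSpace ℝ (Fin d))
    (j : Fin d) : (diagMap a b)^[n] y j - (diagMap a b)^[n] z j = a j ^ n * (y j - z j) := by
  induction n with
  | zero => simp
  | succ n ih =>
    rw [Function.iterate_succ_apply', Function.iterate_succ_apply', pow_succ', mul_assoc, ← ih]
    simp only [diagMap]
    ring

theorem IsLalleyGatzourasSponge.not_uniformlyDisconnected {Φ : DiagonalIFS d N}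
    {K : Set (EuclideanSpace ℝ (Fin d))} (hK : Φ.IsLalleyGatzourasSponge K) {ℓ : ℕ} (hℓ : ℓ < d)
    (k : Fin N) (h : IsAttractor (Φ.fiberIFS ℓ hℓ (Φ.projMap ℓ hℓ.le k)) (Icc (0 : ℝ) 1)) :
    ¬ UniformlyDisconnected K := by
  rintro ⟨δ, hδ, hno⟩
  apply hno
  have hd : (0 : ℝ) < d := by exact_mod_cast (Nat.zero_le ℓ).trans_lt hℓ
  set i₀ : Fin d := ⟨ℓ, hℓ⟩ with hi₀
  have ht0 := Φ.ratio_pos k i₀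
  -- Spacing 1/m < δ/d handles direction ℓ, and n below handles the faster directions; the factor d
  -- is lost in passing from coordinates to the Euclidean distance.
  obtain ⟨m, hm⟩ := exists_nat_gt (d / δ)
  have hm0 : (0 : ℝ) < m := (div_pos hd hδ).trans hm
  have hm1 : 1 ≤ m := Nat.one_le_iff_ne_zero.2 (by rintro rfl; simp at hm0)
  obtain ⟨n, hn⟩ : ∃ n : ℕ, ∀ j : Fin d, ℓ < j.val →
      (Φ.ratio k j / Φ.ratio k i₀) ^ n ≤ δ / d := by
    refine Filter.Eventually.exists (f := Filter.atTop) (Filter.eventually_all.2 fun j => ?_)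
    by_cases hj : ℓ < j.val
    · have h1 : Φ.ratio k j / Φ.ratio k i₀ < 1 := by
        rw [div_lt_one ht0]
        exact hK.coordinateOrdering k (show i₀ < j from hj)
      have hlim := tendsto_pow_atTop_nhds_zero_of_lt_one
        (div_pos (Φ.ratio_pos k j) ht0).le h1
      filter_upwards [hlim.eventually (ge_mem_nhds (div_pos hδ hd))] with n hn _
      exact hn
    · exact Filter.Eventually.of_forall fun n h => absurd h hj
  choose y hyK hyp hyt using fun i : Fin (m + 1) =>
    hK.exists_mem_fiber hℓ k h (t := (i : ℝ) / m)
      ⟨by positivity, by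
        rw [div_le_one hm0]; exact_mod_cast Nat.lt_succ_iff.1 i.isLt⟩
  let φ := (diagMap (Φ.ratio k) (Φ.shift k))^[n]
  have hdiff : ∀ i i' j, φ (y i) j - φ (y i') j = Φ.ratio k j ^ n * (y i j - y i' j) :=
    fun i i' j => iterate_diagMap_sub _ _ _ _ _ _
  have htn : 0 < Φ.ratio k i₀ ^ n := pow_pos ht0 n
  refine ⟨m, fun i => ⟨φ (y i), hK.iterate_mem k n (hyK i)⟩, hm1, fun i i' hii' => ?_, fun i => ?_⟩
  · have h1 : φ (y i) = φ (y i') := congrArg Subtype.val hii'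
    have h2 := hdiff i i' i₀
    rw [h1, sub_self, hyt, hyt, eq_comm, mul_eq_zero, or_iff_right htn.ne', sub_eq_zero,
      div_left_inj' hm0.ne'] at h2
    exact Fin.ext (by exact_mod_cast h2)
  · have hfar : Φ.ratio k i₀ ^ n ≤ dist (φ (y 0)) (φ (y (Fin.last m))) := by
      refine le_trans (le_of_eq ?_) (abs_coord_le_dist _ _ i₀)
      rw [hdiff, hyt, hyt]
      simp [hm0.ne', abs_of_pos ht0]
    have hnear : dist (φ (y i.castSucc)) (φ (y i.succ)) ≤
        d * (δ / d * Φ.ratio k i₀ ^ n) := by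
      refine dist_le_of_abs_le fun j => ?_
      rw [hdiff, abs_mul, abs_of_pos (pow_pos (Φ.ratio_pos k j) n)]
      rcases lt_trichotomy j.val ℓ with hj | hj | hj
      · rw [hyp _ j hj, hyp _ j hj, sub_self, abs_zero, mul_zero]
        positivity
      · obtain rfl : j = i₀ := Fin.ext hj
        rw [hyt, hyt, mul_comm]
        refine mul_le_mul_of_nonneg_right ?_ htn.le
        have : ((i.castSucc : Fin (m + 1)) : ℝ) / m - ((i.succ : Fin (m + 1)) : ℝ) / m =
            -(1 / m) := by
          simp only [Fin.val_castSucc, Fin.val_succ]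
          push_cast
          ring
        rw [this, abs_neg, abs_of_pos (by positivity), div_le_div_iff₀ hm0 hd]
        rw [div_lt_iff₀ hδ] at hm
        linarith
      · have h1 := hn j hj
        rw [div_pow, div_le_iff₀ htn] at h1
        have h2 := hK.subset_cube _ (hyK i.castSucc) j
        have h3 := hK.subset_cube _ (hyK i.succ) j
        have h4 : |y i.castSucc j - y i.succ j| ≤ 1 := by
          rw [abs_le]
          constructor <;> linarith [h2.1, h2.2, h3.1, h3.2]
        exact (mul_le_of_le_one_right (pow_pos (Φ.ratio_pos k j) n).le h4).trans h1
    have e : (d : ℝ) * (δ / d * Φ.ratio k i₀ ^ n) = δ * Φ.ratio k i₀ ^ n := by field_simp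
    rw [e] at hnear
    exact hnear.trans (mul_le_mul_of_nonneg_left hfar hδ.le)

end DiagonalIFS

theorem mainTheorem2 {d N : ℕ} (hd : 1 ≤ d) (Φ : DiagonalIFS d N)
    (K : Set (EuclideanSpace ℝ (Fin d))) (hK : Φ.IsLalleyGatzourasSponge K) :
    List.TFAE
      [UniformlyDisconnected K,
       ∀ (ℓ : ℕ) (hℓ : ℓ ≤ d), 1 ≤ ℓ → IsTotallyDisconnected (majorProj hℓ '' K),
       ∀ (ℓ : ℕ) (hℓ : ℓ < d), ∀ u ∈ Φ.projMaps ℓ hℓ.le,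
         ¬ IsAttractor (Φ.fiberIFS ℓ hℓ u) (Icc (0 : ℝ) 1)] := by
  tfae_have 1 → 3 := by
    rintro h ℓ hℓ _ ⟨k, rfl⟩ hA
    exact hK.not_uniformlyDisconnected hℓ k hA h
  tfae_have 2 → 3 := by
    rintro h ℓ hℓ _ ⟨k, rfl⟩ hA
    exact hK.not_isTotallyDisconnected hℓ k hA (h (ℓ + 1) hℓ (Nat.le_add_left 1 ℓ))
  tfae_have 3 → 1 := fun h => (hK.chainBound h d le_rfl).uniformlyDisconnected hd
  tfae_have 3 → 2 := fun h ℓ hℓ _ => (hK.chainBound h ℓ hℓ).isTotallyDisconnected hℓ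
  tfae_finish
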